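/- Let $X$ be a path-connected topological space, let $Y$ be a connected topological manifold without boundary (Hausdorff, second countable, locally homeomorphic to some $\mathbb R^d$, not necessarily compact), let $c\in Y$, and let $\bar c: X\to Y$ be the constant map at $c$. Let $k\ge 2$ and let $f_2,\dots,f_k: X\to Y$ be any continuous maps. Then either $N(\bar c,f_2,\dots,f_k)=0$ or $N(\bar c,f_2,\dots,f_k)=R(\bar c,f_2,\dots,f_k)$ (an equality of cardinal numbers). Here, for maps $f_1,\dots,f_k:X\to Y$, let $\mathrm{Coin}(f_1,\dots,f_k)=\{x\in X: f_1(x)=\dots=f_k(x)\}$. Two points $x_0,x_1$ of this set are Nielsen equivalent if there is a path $\gamma$ in $X$ from $x_0$ to $x_1$ such that $f_1\circ\gamma$ is homotopic to $f_j\circ\gamma$ relative to the endpoints for $j=2,\dots,k$; the equivalence classes are the Nielsen coincidence classes of $(f_1,\dots,f_k)$. Given homotopies $\{f_i^t\}$ with $f_i^0=f_i$, a Nielsen class $\mathcal F$ of $(f_1,\dots,f_k)$ and a Nielsen class $\mathcal F'$ of $(f_1^1,\dots,f_k^1)$ are related by these homotopies if there are $x\in\mathcal F$, $x'\in\mathcal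 F'$ and a path $\gamma$ from $x$ to $x'$ such that the paths $t\mapsto f_1^t(\gamma(t))$ and $t\mapsto f_i^t(\gamma(t))$ are homotopic relative to the endpoints for $i=2,\dots,k$. A Nielsen class $\mathcal F$ is essential if for all homotopies $\{f_1^t\},\dots,\{f_k^t\}$ of $f_1,\dots,f_k$ it is related by them to some Nielsen class of $(f_1^1,\dots,f_k^1)$. The (geometric) Nielsen coincidence number $N(f_1,\dots,f_k)$ is the number of essential Nielsen classes. For base points $x_0\in X$, $y_0\in Y$ and paths $w_i$ from $f_i(x_0)$ to $y_0$, let $\phi_i:\pi_1(X,x_0)\to\pi_1(Y,y_0)$ be the homomorphism induced by $f_i$ followed by the change of base point along $w_i$. The Reidemeister number $R(f_1,\dots,f_k)$ is the cardinality of the quotient of $\pi_1(Y,y_0)^{k-1}$ by the relation $(\alpha_2,\dots,\alpha_k)\sim(\beta_2,\dots,\beta_k)$ if and only if there is $z\in\pi_1(X,x_0)$ with $\beta_i=\phi_1(z)\alpha_i\phi_i(z)^{-1}$ for $i=2,\dots,k$; the statement holds for every choice of $x_0$, $y_0$ and $w_i$. -/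

import Mathlib

open scoped unitInterval

universe u v

noncomputable section

/-! ### Coincidences of several maps and their Nielsen classes

A `k`-tuple of maps `f₁, …, f_k` with `k = n + 1 ≥ 1` is a family indexed by `Fin (n + 1)`; the
first map is `f 0` and the others are `f i.succ` for `i : Fin n`. -/

section Nielsen

variable {X : Type u} {Y : Type v} [TopologicalSpace X] [TopologicalSpace Y] {n : ℕ}

/-- The coincidence set `Coin(f₁, …, f_k) = {x | f₁ x = ⋯ = f_k x}`. -/
def CoinSet (f : Fin (n + 1) → C(X, Y)) : Set X :=
  {x | ∀ i j, f i x = f j x}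

/-- Nielsen equivalence: there is a path `γ` in `X` from `x₀` to `x₁` such that `f₁ ∘ γ` is
homotopic to `f_j ∘ γ` relative to the endpoints for `j = 2, …, k`. -/
def NielsenEquiv (f : Fin (n + 1) → C(X, Y)) (x₀ x₁ : X) : Prop :=
  ∃ γ : Path x₀ x₁, ∀ i : Fin n,
    ((f 0).comp γ.toContinuousMap).HomotopicRel ((f i.succ).comp γ.toContinuousMap) {0, 1}

theorem nielsenEquiv_refl (f : Fin (n + 1) → C(X, Y)) (x : CoinSet f) :
    NielsenEquiv f x x := by
  refine ⟨Path.refl _, fun i => ?_⟩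
  have h : (f 0).comp (Path.refl (x : X)).toContinuousMap
      = (f i.succ).comp (Path.refl (x : X)).toContinuousMap := by
    ext t
    exact x.2 0 i.succ
  rw [h]
  exact .refl _

theorem nielsenEquiv_symm (f : Fin (n + 1) → C(X, Y)) {x y : X} (h : NielsenEquiv f x y) :
    NielsenEquiv f y x := by
  obtain ⟨γ, hγ⟩ := h
  refine ⟨γ.symm, fun i => ?_⟩
  have h0 : f i.succ x = f 0 x := by
    simpa using ((hγ i).fst_eq_snd (x := 0) (by simp)).symm
  have h1 : f i.succ y = f 0 y := by
    simpa using ((hγ i).fst_eq_snd (x := 1) (by simp)).symm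
  have e : (γ.map (f 0).continuous).Homotopic
      ((γ.map (f i.succ).continuous).cast h0.symm h1.symm) := hγ i
  exact e.symm₂

theorem nielsenEquiv_trans (f : Fin (n + 1) → C(X, Y)) {x y z : X} (h : NielsenEquiv f x y)
    (h' : NielsenEquiv f y z) : NielsenEquiv f x z := by
  obtain ⟨γ, hγ⟩ := h
  obtain ⟨δ, hδ⟩ := h'
  refine ⟨γ.trans δ, fun i => ?_⟩
  have h0 : f i.succ x = f 0 x := by
    simpa using ((hγ i).fst_eq_snd (x := 0) (by simp)).symm
  have h1 : f i.succ y = f 0 y := by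
    simpa using ((hγ i).fst_eq_snd (x := 1) (by simp)).symm
  have h2 : f i.succ z = f 0 z := by
    simpa using ((hδ i).fst_eq_snd (x := 1) (by simp)).symm
  have e : (γ.map (f 0).continuous).Homotopic
      ((γ.map (f i.succ).continuous).cast h0.symm h1.symm) := hγ i
  have e' : (δ.map (f 0).continuous).Homotopic
      ((δ.map (f i.succ).continuous).cast h1.symm h2.symm) := hδ i
  have E := e.hcomp e'
  have a : (γ.map (f 0).continuous).trans (δ.map (f 0).continuous)
      = (γ.trans δ).map (f 0).continuous := (Path.map_trans _ _ _).symm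
  have b : ((γ.map (f i.succ).continuous).cast h0.symm h1.symm).trans
        ((δ.map (f i.succ).continuous).cast h1.symm h2.symm)
      = ((γ.trans δ).map (f i.succ).continuous).cast h0.symm h2.symm := by
    rw [Path.map_trans]
    rfl
  rw [a, b] at E
  exact E

/-- Nielsen equivalence as an equivalence relation on the coincidence set. -/
def nielsenSetoid (f : Fin (n + 1) → C(X, Y)) : Setoid (CoinSet f) where
  r x y := NielsenEquiv f x y
  iseqv := ⟨nielsenEquiv_refl f, nielsenEquiv_symm f, nielsenEquiv_trans f⟩

/-- The Nielsen coincidence classes of `(f₁, …, f_k)`. -/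
def NielsenClass (f : Fin (n + 1) → C(X, Y)) : Type u :=
  Quotient (nielsenSetoid f)

/-- The path `t ↦ hᵗ(γ(t))` obtained by running a homotopy along a path. -/
def diagonalPath {f g : C(X, Y)} (h : f.Homotopy g) {x x' : X} (γ : Path x x') : C(I, Y) :=
  h.toContinuousMap.comp ((ContinuousMap.id I).prodMk γ.toContinuousMap)

/-- Given homotopies from `f_i` to `g_i`, a Nielsen class `F` of `(f₁, …, f_k)` and a Nielsen class
`F'` of `(g₁, …, g_k)` are related by these homotopies if there are `x ∈ F`, `x' ∈ F'` and a path
`γ` from `x` to `x'` such that `t ↦ f₁ᵗ(γ(t))` and `t ↦ f_iᵗ(γ(t))` are homotopic relative to the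
endpoints for `i = 2, …, k`. -/
def NielsenClass.Related {f g : Fin (n + 1) → C(X, Y)} (h : ∀ i, (f i).Homotopy (g i))
    (F : NielsenClass f) (F' : NielsenClass g) : Prop :=
  ∃ (x : CoinSet f) (x' : CoinSet g), Quotient.mk (nielsenSetoid f) x = F ∧
    Quotient.mk (nielsenSetoid g) x' = F' ∧
    ∃ γ : Path (x : X) (x' : X), ∀ i : Fin n,
      (diagonalPath (h 0) γ).HomotopicRel (diagonalPath (h i.succ) γ) {0, 1}

/-- A Nielsen class is (geometrically) essential if under all homotopies of `f₁, …, f_k` it is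
related to some Nielsen class of the resulting maps. -/
def NielsenClass.Essential {f : Fin (n + 1) → C(X, Y)} (F : NielsenClass f) : Prop :=
  ∀ (g : Fin (n + 1) → C(X, Y)) (h : ∀ i, (f i).Homotopy (g i)),
    ∃ F' : NielsenClass g, NielsenClass.Related h F F'

/-- The (geometric) Nielsen coincidence number `N(f₁, …, f_k)`: the number of essential Nielsen
coincidence classes. -/
def nielsenNumber (f : Fin (n + 1) → C(X, Y)) : Cardinal.{u} :=
  Cardinal.mk {F : NielsenClass f // F.Essential}

/-! ### Reidemeister classes -/

/-- The Reidemeister relation on `H ^ (k - 1)` of homomorphisms `φ₁, …, φ_k : G → H`: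
`(α₂, …, α_k) ∼ (β₂, …, β_k)` if and only if for some `z`, `β_i = φ₁(z) α_i φ_i(z)⁻¹` for
`i = 2, …, k`. -/
def reidemeisterSetoid {G H : Type*} [Group G] [Group H] (φ : Fin (n + 1) → G →* H) :
    Setoid (Fin n → H) where
  r α β := ∃ z : G, ∀ i : Fin n, β i = φ 0 z * α i * (φ i.succ z)⁻¹
  iseqv := by
    refine ⟨fun α => ⟨1, fun i => by simp⟩, ?_, ?_⟩
    · rintro α β ⟨z, hz⟩
      exact ⟨z⁻¹, fun i => by simp [hz, mul_assoc]⟩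
    · rintro α β δ ⟨z, hz⟩ ⟨w, hw⟩
      exact ⟨w * z, fun i => by simp [hz, hw, mul_assoc]⟩

/-- The homomorphism `π₁(X, x₀) → π₁(Y, y₀)` induced by `g : X → Y` and a path `w` from `g x₀` to
the base point `y₀` of `Y`. The choice of `w` amounts to the choice of a lift of `g` to universal
covers. -/
def inducedHom (g : C(X, Y)) (x₀ : X) {y₀ : Y} (w : Path (g x₀) y₀) :
    FundamentalGroup X x₀ →* FundamentalGroup Y y₀ :=
  (FundamentalGroup.fundamentalGroupMulEquivOfPath w).toMonoidHom.comp (FundamentalGroup.map g x₀)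

/-- The Reidemeister number `R(f₁, …, f_k)`: the number of Reidemeister classes of the induced
homomorphisms `φ_i : π₁(X, x₀) → π₁(Y, y₀)`, where base points `x₀`, `y₀` and, for each `i`, a path
`w i` from `f_i x₀` to `y₀` have been chosen to define `φ_i`. (Mathlib's product in the fundamental
group is concatenation in the opposite order; inverting all `α_i` and `z` identifies the
Reidemeister classes for the two conventions.) -/
def reidemeisterNumber (f : Fin (n + 1) → C(X, Y)) (x₀ : X) (y₀ : Y)
    (w : ∀ i, Path (f i x₀) y₀) : Cardinal.{v} :=
  Cardinal.mk (Quotient (reidemeisterSetoid fun i => inducedHom (f i) x₀ (w i)))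

end Nielsen

end

/-! The heart of the matter is that coincidences of a constant map can be twisted by arbitrary loops
at `c`. `exists_path_tracking` provides self-maps `Λ P t` of the manifold, continuous in the path
`P`, the time and the point, that start at the identity and for which `P 0` is the only preimage of
`P t`. They need not be homeomorphisms. They are composed from pushes inside charts: a partition of
unity on `Y` handles short paths, and a modulus of continuity depending continuously on `P` cuts
long paths into short ones.

Let the class of `x` be essential, let homotopies lead from `f` to `g`, and let `q x` be the track
of `x` under the homotopy of the constant map. Prolong the homotopy of each other map by `Λ` along
the loop `(q x)⁻¹ ωᵢ⁻¹ (q x)` at `g 0 x`. No coincidence is created or destroyed, but the tracks at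
coincidences change by these loops. Essentiality applied to the prolonged homotopies, with the loops
then cancelled, gives a coincidence of `g` related to `x` up to the twist `ω`
(`exists_twisted_coincidence`). Hence all twists of an essential class exist and are essential
(`exists_twisted_essential`).

Since `X` is path-connected, every class is a twist of `x`, and the twists realise all Reidemeister
coordinates. As `φ₁` is trivial, two coincidences are Nielsen equivalent exactly when their
coordinates are Reidemeister equivalent (`Represents.nielsenEquiv_iff`). One essential class
therefore forces a bijection of all Nielsen classes with Reidemeister classes. -/

open Set Filter Topology Uniformity

/-! ### Pushing points inside a chart -/

section BallPush

variable {E : Type*} [NormedAddCommGroup E]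

/-- A cutoff equal to `1` on the ball of radius `r` and to `0` outside the ball of radius `3 * r`. -/
noncomputable def radialCutoff (p : E) (r : ℝ) (x : E) : ℝ :=
  max 0 (min 1 ((3 * r - ‖x - p‖) / (2 * r)))

theorem continuous_radialCutoff (p : E) (r : ℝ) : Continuous (radialCutoff p r) := by
  unfold radialCutoff
  fun_prop

theorem radialCutoff_eq_zero {p : E} {r : ℝ} (hr : 0 < r) {x : E} (hx : 3 * r ≤ ‖x - p‖) :
    radialCutoff p r x = 0 := by
  refine max_eq_left ((min_le_right _ _).trans ?_)
  exact div_nonpos_of_nonpos_of_nonneg (by linarith) (by positivity)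

theorem radialCutoff_eq_one {p : E} {r : ℝ} (hr : 0 < r) {x : E} (hx : ‖x - p‖ ≤ r) :
    radialCutoff p r x = 1 := by
  have : 1 ≤ (3 * r - ‖x - p‖) / (2 * r) := by
    rw [le_div_iff₀ (by positivity)]
    linarith
  rw [radialCutoff, min_eq_left this]
  simp

variable [NormedSpace ℝ E]

/-- The cutoff falls off with slope `1 / (2 * r)`, so a point is displaced by less than its distance
to the sphere of radius `3 * r`. -/
theorem add_radialCutoff_smul_mem_ball {p : E} {r : ℝ} (hr : 0 < r) {v x : E} (hv : ‖v‖ < 2 * r)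
    (hx : ‖x - p‖ < 3 * r) : ‖x + radialCutoff p r x • v - p‖ < 3 * r := by
  have h0 : 0 ≤ radialCutoff p r x := le_max_left _ _
  have h1 : radialCutoff p r x ≤ (3 * r - ‖x - p‖) / (2 * r) :=
    max_le (div_nonneg (by linarith) (by positivity)) (min_le_right _ _)
  have h3 : 0 < (3 * r - ‖x - p‖) / (2 * r) := div_pos (by linarith) (by positivity)
  have h2 : ‖x + radialCutoff p r x • v - p‖ ≤ ‖x - p‖ + radialCutoff p r x * ‖v‖ := by
    have : x + radialCutoff p r x • v - p = (x - p) + radialCutoff p r x • v := by abel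
    rw [this]
    refine (norm_add_le _ _).trans ?_
    rw [norm_smul, Real.norm_of_nonneg h0]
  have h4 : radialCutoff p r x * ‖v‖ < (3 * r - ‖x - p‖) / (2 * r) * (2 * r) :=
    (mul_le_mul_of_nonneg_right h1 (norm_nonneg _)).trans_lt (mul_lt_mul_of_pos_left hv h3)
  rw [div_mul_cancel₀ _ (by positivity)] at h4
  linarith

/-- The cutoff is 1 at `a` and has slope at most `1 / (2 * r)`, while `‖b - a‖ < 2 * r`. A second
preimage `x` of `b` would satisfy `‖x - a‖ ≤ ‖x - a‖ / (2 * r) * ‖b - a‖ < ‖x - a‖`. -/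
theorem add_radialCutoff_smul_eq_iff {p : E} {r : ℝ} (hr : 0 < r) {a b x : E}
    (ha : ‖a - p‖ < r) (hb : ‖b - p‖ < r) :
    x + radialCutoff p r x • (b - a) = b ↔ x = a := by
  have hv : ‖b - a‖ < 2 * r := by
    have : b - a = (b - p) - (a - p) := by abel
    rw [this]
    linarith [norm_sub_le (b - p) (a - p)]
  constructor
  · intro h
    have h1 : x - a = (1 - radialCutoff p r x) • (b - a) := by
      rw [sub_smul, one_smul, eq_sub_iff_add_eq, sub_add_eq_add_sub, h]
    have h2 : ‖x - p‖ ≤ ‖x - a‖ + r := by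
      have : x - p = (x - a) + (a - p) := by abel
      rw [this]
      linarith [norm_add_le (x - a) (a - p)]
    have h3 : 1 - radialCutoff p r x ≤ ‖x - a‖ / (2 * r) := by
      have : 1 - ‖x - a‖ / (2 * r) ≤ radialCutoff p r x := by
        refine le_max_of_le_right (le_min ?_ ?_)
        · have : 0 ≤ ‖x - a‖ / (2 * r) := by positivity
          linarith
        · rw [le_div_iff₀ (by positivity), sub_mul, div_mul_cancel₀ _ (by positivity)]
          linarith
      linarith
    have h4 : 0 ≤ 1 - radialCutoff p r x := by
      have : radialCutoff p r x ≤ 1 := max_le zero_le_one (min_le_left _ _)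
      linarith
    have h5 : ‖x - a‖ ≤ ‖x - a‖ / (2 * r) * ‖b - a‖ := by
      nth_rewrite 1 [h1]
      rw [norm_smul, Real.norm_of_nonneg h4]
      exact mul_le_mul_of_nonneg_right h3 (norm_nonneg _)
    by_contra hne
    have h6 : 0 < ‖x - a‖ := norm_pos_iff.2 (sub_ne_zero.2 hne)
    have h7 : ‖x - a‖ / (2 * r) * ‖b - a‖ < ‖x - a‖ / (2 * r) * (2 * r) :=
      mul_lt_mul_of_pos_left hv (by positivity)
    rw [div_mul_cancel₀ _ (by positivity)] at h7
    linarith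
  · rintro rfl
    rw [radialCutoff_eq_one hr ha.le, one_smul]
    abel

end BallPush

/-- Around each point of a manifold there are an open set `U` and a family of maps `φ a b`, jointly
continuous over `a, b ∈ U`, such that `φ a b` moves `a`, and nothing else, to `b`. -/
theorem exists_local_push {E : Type*} [NormedAddCommGroup E] [NormedSpace ℝ E] [ProperSpace E]
    {Y : Type*} [TopologicalSpace Y] [T2Space Y] [ChartedSpace E Y] (y : Y) :
    ∃ (U : Set Y) (φ : Y → Y → Y → Y), IsOpen U ∧ y ∈ U ∧ (∀ a z, φ a a z = z) ∧
      (∀ a ∈ U, ∀ b ∈ U, ∀ z, φ a b z = b ↔ z = a) ∧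
      ∀ a ∈ U, ∀ b ∈ U, ∀ z, ContinuousAt (fun q : Y × Y × Y => φ q.1 q.2.1 q.2.2) (a, b, z) := by
  classical
  set e := chartAt E y
  have hy : y ∈ e.source := mem_chart_source E y
  obtain ⟨R, hR, hRt⟩ := Metric.nhds_basis_closedBall.mem_iff.1
    (e.open_target.mem_nhds (e.map_source hy))
  obtain ⟨r, hr, rfl⟩ : ∃ r, 0 < r ∧ R = 3 * r := ⟨R / 3, by positivity, by ring⟩
  set p := e y
  set F : E → E → E → E := fun a b x => x + radialCutoff p r x • (b - a) with hF
  have hFc : Continuous fun q : E × E × E => F q.1 q.2.1 q.2.2 := by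
    have := continuous_radialCutoff p r
    fun_prop
  have hFt : ∀ a b x, ‖a - p‖ < r → ‖b - p‖ < r → x ∈ e.target → F a b x ∈ e.target := by
    intro a b x ha hb hx
    by_cases h : ‖x - p‖ < 3 * r
    · refine hRt (mem_closedBall_iff_norm.2 (add_radialCutoff_smul_mem_ball hr ?_ h).le)
      have : b - a = (b - p) - (a - p) := by abel
      rw [this]
      linarith [norm_sub_le (b - p) (a - p)]
    · simpa [hF, radialCutoff_eq_zero hr (not_lt.1 h)] using hx
  -- `K` is compact, hence closed in the Hausdorff space `Y`, and the push is the identity off `K`.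
  -- This gives continuity at points outside the chart.
  set K : Set Y := e.symm '' Metric.closedBall p (3 * r)
  have hK : IsClosed K :=
    ((isCompact_closedBall p (3 * r)).image_of_continuousOn
      (e.continuousOn_symm.mono hRt)).isClosed
  have hKs : K ⊆ e.source := by
    rintro _ ⟨x, hx, rfl⟩
    exact e.map_target (hRt hx)
  set φ : Y → Y → Y → Y := fun a b z =>
    if z ∈ e.source then e.symm (F (e a) (e b) (e z)) else z with hφ
  have hφK : ∀ a b z, z ∉ K → φ a b z = z := by
    intro a b z hz
    by_cases hzs : z ∈ e.source
    · have : 3 * r ≤ ‖e z - p‖ := by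
        by_contra! h
        exact hz ⟨e z, mem_closedBall_iff_norm.2 h.le, e.left_inv hzs⟩
      simp [hφ, hF, hzs, radialCutoff_eq_zero hr this]
    · simp [hφ, hzs]
  refine ⟨e.source ∩ e ⁻¹' Metric.ball p r, φ, e.isOpen_inter_preimage Metric.isOpen_ball,
    ⟨hy, Metric.mem_ball_self hr⟩, ?_, ?_, ?_⟩
  · intro a z
    by_cases hzs : z ∈ e.source <;> simp [hφ, hF, hzs]
  · rintro a ⟨has, ha⟩ b ⟨hbs, hb⟩ z
    rw [mem_preimage, mem_ball_iff_norm] at ha hb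
    by_cases hzs : z ∈ e.source
    · have h1 : φ a b z = e.symm (F (e a) (e b) (e z)) := by simp [hφ, hzs]
      rw [h1, ← e.injOn.eq_iff hzs has, ← add_radialCutoff_smul_eq_iff hr ha hb,
        ← e.injOn.eq_iff (e.map_target (hFt _ _ _ ha hb (e.map_source hzs))) hbs,
        e.right_inv (hFt _ _ _ ha hb (e.map_source hzs))]
    · have h1 : φ a b z = z := by simp [hφ, hzs]
      rw [h1]
      constructor
      · rintro rfl
        exact absurd hbs hzs
      · rintro rfl
        exact absurd has hzs
  · rintro a ⟨has, ha⟩ b ⟨hbs, hb⟩ z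
    rw [mem_preimage, mem_ball_iff_norm] at ha hb
    by_cases hzs : z ∈ e.source
    · have h1 : (fun q : Y × Y × Y => φ q.1 q.2.1 q.2.2) =ᶠ[𝓝 (a, b, z)]
          fun q => e.symm (F (e q.1) (e q.2.1) (e q.2.2)) := by
        have : ∀ᶠ q : Y × Y × Y in 𝓝 (a, b, z), q.2.2 ∈ e.source :=
          (continuous_snd.snd.tendsto (a, b, z)).eventually (e.open_source.mem_nhds hzs)
        filter_upwards [this] with q hq
        simp [hφ, hq]
      refine ContinuousAt.congr ?_ h1.symm
      have c1 : ContinuousAt (fun q : Y × Y × Y => e q.1) (a, b, z) :=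
        (e.continuousAt has).comp_of_eq continuousAt_fst rfl
      have c2 : ContinuousAt (fun q : Y × Y × Y => e q.2.1) (a, b, z) :=
        (e.continuousAt hbs).comp_of_eq continuous_snd.fst.continuousAt rfl
      have c3 : ContinuousAt (fun q : Y × Y × Y => e q.2.2) (a, b, z) :=
        (e.continuousAt hzs).comp_of_eq continuous_snd.snd.continuousAt rfl
      exact (e.continuousAt_symm (hFt _ _ _ ha hb (e.map_source hzs))).comp_of_eq
        (hFc.continuousAt.comp_of_eq (c1.prodMk (c2.prodMk c3)) rfl) rfl
    · have h1 : (fun q : Y × Y × Y => φ q.1 q.2.1 q.2.2) =ᶠ[𝓝 (a, b, z)] fun q => q.2.2 := by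
        have : ∀ᶠ q : Y × Y × Y in 𝓝 (a, b, z), q.2.2 ∈ Kᶜ :=
          (continuous_snd.snd.tendsto (a, b, z)).eventually
            (hK.isOpen_compl.mem_nhds fun h => hzs (hKs h))
        filter_upwards [this] with q hq
        exact hφK _ _ _ hq
      exact continuous_snd.snd.continuousAt.congr h1.symm

/-! ### Locally finite infinite compositions -/

section IterComp

variable {B Y : Type*}

/-- The composition `g (N - 1) b ∘ ⋯ ∘ g 0 b`. -/
def iterComp (g : ℕ → B → Y → Y) (b : B) (z : Y) : ℕ → Y
  | 0 => z
  | N + 1 => g N b (iterComp g b z N)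

theorem iterComp_eq_of_le {g : ℕ → B → Y → Y} {b : B} {N M : ℕ} (hNM : N ≤ M)
    (h : ∀ m, N ≤ m → ∀ z, g m b z = z) (z : Y) : iterComp g b z M = iterComp g b z N := by
  induction M, hNM using Nat.le_induction with
  | base => rfl
  | succ M hM ih => rw [iterComp, h M hM, ih]

theorem iterComp_eq_iff {g : ℕ → B → Y → Y} {a : ℕ → B → Y}
    (h : ∀ m b z, g m b z = a (m + 1) b ↔ z = a m b) (b : B) (z : Y) (N : ℕ) :
    iterComp g b z N = a N b ↔ z = a 0 b := by
  induction N with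
  | zero => rfl
  | succ N ih => rw [iterComp, h, ih]

/-- Near each parameter only finitely many factors differ from the identity, so the infinite
composition is locally a finite one. Uniqueness of the preimage passes through one factor at a time.
-/
theorem exists_continuous_infinite_comp [TopologicalSpace B] [TopologicalSpace Y]
    (g : ℕ → B → Y → Y) (hg : ∀ m, Continuous fun q : B × Y => g m q.1 q.2)
    (hloc : ∀ b, ∃ N, ∀ᶠ b' in 𝓝 b, ∀ m, N ≤ m → ∀ z, g m b' z = z)
    (a : ℕ → B → Y) (a' : B → Y) (ha : ∀ m b z, g m b z = a (m + 1) b ↔ z = a m b)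
    (ha' : ∀ b, ∃ N, ∀ m, N ≤ m → a m b = a' b) :
    ∃ G : B → Y → Y, Continuous (fun q : B × Y => G q.1 q.2) ∧
      (∀ b z, G b z = a' b ↔ z = a 0 b) ∧ ∀ b, (∀ m z, g m b z = z) → ∀ z, G b z = z := by
  choose N hN using hloc
  -- The chosen `N b` may jump with `b`; the value does not depend on where the composition is cut
  -- off.
  have key : ∀ b M, (∀ m, M ≤ m → ∀ z, g m b z = z) → ∀ z,
      iterComp g b z (N b) = iterComp g b z M := by
    intro b M hM z
    rw [← iterComp_eq_of_le (le_max_left (N b) M) (hN b).self_of_nhds,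
      ← iterComp_eq_of_le (le_max_right (N b) M) hM]
  refine ⟨fun b z => iterComp g b z (N b), ?_, ?_, ?_⟩
  · have hc : ∀ M, Continuous fun q : B × Y => iterComp g q.1 q.2 M := by
      intro M
      induction M with
      | zero => exact continuous_snd
      | succ M ih => exact (hg M).comp (continuous_fst.prodMk ih)
    refine continuous_iff_continuousAt.2 fun ⟨b, z⟩ => ((hc (N b)).continuousAt).congr ?_
    filter_upwards [(continuous_fst.tendsto (b, z)).eventually (hN b)] with q hq
    exact (key q.1 (N b) hq q.2).symm
  · intro b z
    obtain ⟨M, hM⟩ := ha' b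
    have h1 := (hN b).self_of_nhds
    rw [← iterComp_eq_iff ha b z (max (N b) M), hM _ (le_max_right _ _),
      iterComp_eq_of_le (le_max_left _ _) h1]
  · intro b hb z
    exact key b 0 (fun m _ => hb m) z

end IterComp

/-! ### Following a path in a manifold -/

/-- Families of sufficiently short paths in a manifold can be followed by self-maps which move the
start of the path, and nothing else, to its end. -/
theorem exists_short_path_tracking {E : Type*} [NormedAddCommGroup E] [NormedSpace ℝ E]
    [ProperSpace E] {Y : Type*} [TopologicalSpace Y] [T2Space Y] [SecondCountableTopology Y]
    [Nonempty Y] [ChartedSpace E Y] :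
    ∃ W : Set (Y × Y), (∀ y, W ∈ 𝓝 (y, y)) ∧
      ∀ {B : Type*} [TopologicalSpace B] (Q : B → ℝ → Y),
        Continuous (fun q : B × ℝ => Q q.1 q.2) →
        (∀ b, ∀ u ∈ Icc (0 : ℝ) 1, (Q b 0, Q b u) ∈ W) →
        ∃ G : B → Y → Y, Continuous (fun q : B × Y => G q.1 q.2) ∧
          (∀ b z, G b z = Q b 1 ↔ z = Q b 0) ∧
          ∀ b, (∀ u ∈ Icc (0 : ℝ) 1, Q b u = Q b 0) → ∀ z, G b z = z := by
  have : LocallyCompactSpace Y := ChartedSpace.locallyCompactSpace E Y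
  choose U φ hUo hyU hφid hφ hφc using exists_local_push (E := E) (Y := Y)
  obtain ⟨s, hs, hsU⟩ := TopologicalSpace.countable_cover_nhds
    fun y => (hUo y).mem_nhds (hyU y)
  have hsne : s.Nonempty := by
    by_contra! h
    simp [h] at hsU
    exact empty_ne_univ hsU
  obtain ⟨y, rfl⟩ := hs.exists_eq_range hsne
  obtain ⟨ψ, hψ⟩ := PartitionOfUnity.exists_isSubordinate isClosed_univ
    (fun m => U (y m)) (fun m => hUo _) (by rw [← hsU, biUnion_range])
  -- With this `W`, whenever the starting point lies in the closed support of `ψ m`, the whole short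
  -- path lies in `U (y m)`, where pushes are available. Local finiteness makes `W` a neighbourhood
  -- of the diagonal.
  refine ⟨{p | ∀ m, p.1 ∈ tsupport (ψ m) → p.2 ∈ U (y m)}, ?_, ?_⟩
  · intro x
    have h1 : ∀ᶠ x' in 𝓝 x, ∀ m ∈ ψ.fintsupport x, x' ∈ U (y m) := by
      rw [Filter.eventually_all_finset]
      intro m hm
      exact (hUo _).mem_nhds (hψ m ((ψ.mem_fintsupport_iff _ _).1 hm))
    rw [nhds_prod_eq]
    filter_upwards [(ψ.eventually_fintsupport_subset x).prod_mk h1] with p hp m hm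
    exact hp.2 m (hp.1 ((ψ.mem_fintsupport_iff _ _).2 hm))
  intro B _ Q hQ hQW
  -- The partial sums of the partition of unity at the starting point serve as subdivision times:
  -- step `m` lasts `ψ m (Q b 0)`, so it is trivial unless its push is defined.
  set Θ : ℕ → Y → ℝ := fun m x => ∑ j ∈ Finset.range m, ψ j x with hΘ
  have hΘc : ∀ m, Continuous (Θ m) := fun m => continuous_finsetSum _ fun j _ => (ψ j).continuous
  have hΘ0 : ∀ m x, 0 ≤ Θ m x := fun m x => Finset.sum_nonneg fun j _ => ψ.nonneg j x
  have hlim : ∀ x, ∃ N, ∀ m, N ≤ m → Θ m x = 1 := by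
    intro x
    refine ⟨(ψ.finsupport x).sup id + 1, fun m hm => ?_⟩
    rw [hΘ, ← ψ.sum_finsupport (mem_univ x)]
    refine (Finset.sum_subset (fun j hj => ?_) fun j _ hj => ?_).symm
    · rw [Finset.mem_range]
      have : j ≤ (ψ.finsupport x).sup id := Finset.le_sup (f := id) hj
      omega
    · simpa [ψ.mem_finsupport] using hj
  have hΘ1 : ∀ m x, Θ m x ≤ 1 := by
    intro m x
    obtain ⟨N, hN⟩ := hlim x
    rw [← hN (max m N) (le_max_right _ _)]
    exact Finset.sum_le_sum_of_subset_of_nonneg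
      (Finset.range_subset_range.2 (le_max_left _ _)) fun j _ _ => ψ.nonneg j x
  set a : ℕ → B → Y := fun m b => Q b (Θ m (Q b 0)) with ha
  have hQ0 : Continuous fun b => Q b 0 := hQ.comp (continuous_id.prodMk continuous_const)
  have hac : ∀ m, Continuous (a m) := fun m =>
    hQ.comp (continuous_id.prodMk ((hΘc m).comp hQ0))
  have haU : ∀ m m' b, Q b 0 ∈ tsupport (ψ m) → a m' b ∈ U (y m) := fun m m' b hb =>
    hQW b _ ⟨hΘ0 _ _, hΘ1 _ _⟩ m hb
  have hstep : ∀ m b, ψ m (Q b 0) = 0 → a (m + 1) b = a m b := by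
    intro m b hb
    simp only [ha, hΘ, Finset.sum_range_succ, hb, add_zero]
  set g : ℕ → B → Y → Y := fun m b z => φ (y m) (a m b) (a (m + 1) b) z with hg
  have hgid : ∀ m b z, a (m + 1) b = a m b → g m b z = z := by
    intro m b z h
    simp only [hg, h, hφid]
  have hgc : ∀ m, Continuous fun q : B × Y => g m q.1 q.2 := by
    intro m
    refine continuous_iff_continuousAt.2 fun ⟨b, z⟩ => ?_
    -- The complement of the closed support is open, so off it the factor is the identity on a whole
    -- neighbourhood.
    by_cases hb : Q b 0 ∈ tsupport (ψ m)
    · exact (hφc (y m) _ (haU m m b hb) _ (haU m (m + 1) b hb) z).comp_of_eq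
        (((hac m).comp continuous_fst).prodMk
          (((hac (m + 1)).comp continuous_fst).prodMk continuous_snd)).continuousAt rfl
    · have h1 : ∀ᶠ q : B × Y in 𝓝 (b, z), Q q.1 0 ∈ (tsupport (ψ m))ᶜ :=
        ((hQ0.comp continuous_fst).tendsto (b, z)).eventually
          ((isClosed_tsupport _).isOpen_compl.mem_nhds hb)
      refine continuousAt_snd.congr ?_
      filter_upwards [h1] with q hq
      exact (hgid _ _ _ (hstep _ _ (image_eq_zero_of_notMem_tsupport hq))).symm
  have hgloc : ∀ b, ∃ N, ∀ᶠ b' in 𝓝 b, ∀ m, N ≤ m → ∀ z, g m b' z = z := by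
    intro b
    refine ⟨(ψ.fintsupport (Q b 0)).sup id + 1, ?_⟩
    filter_upwards [(hQ0.tendsto b).eventually (ψ.eventually_fintsupport_subset (Q b 0))]
      with b' hb' m hm z
    refine hgid _ _ _ (hstep _ _ (image_eq_zero_of_notMem_tsupport fun h => ?_))
    have : m ≤ (ψ.fintsupport (Q b 0)).sup id :=
      Finset.le_sup (f := id) (hb' ((ψ.mem_fintsupport_iff _ _).2 h))
    omega
  have hga : ∀ m b z, g m b z = a (m + 1) b ↔ z = a m b := by
    intro m b z
    by_cases hb : ψ m (Q b 0) = 0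
    · rw [hgid _ _ _ (hstep _ _ hb), hstep _ _ hb]
    · have hb' := subset_tsupport _ (Function.mem_support.2 hb)
      exact hφ (y m) _ (haU _ _ _ hb') _ (haU _ _ _ hb') z
  have halim : ∀ b, ∃ N, ∀ m, N ≤ m → a m b = Q b 1 := by
    intro b
    obtain ⟨N, hN⟩ := hlim (Q b 0)
    exact ⟨N, fun m hm => by simp only [ha, hN m hm]⟩
  obtain ⟨G, hG1, hG2, hG3⟩ := exists_continuous_infinite_comp g hgc hgloc a
    (fun b => Q b 1) hga halim
  refine ⟨G, hG1, fun b z => ?_, fun b hb => hG3 b fun m z => hgid _ _ _ ?_⟩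
  · rw [hG2]
    simp [ha, hΘ]
  · rw [ha]
    beta_reduce
    rw [hb _ ⟨hΘ0 _ _, hΘ1 _ _⟩, hb _ ⟨hΘ0 _ _, hΘ1 _ _⟩]

/-- A continuous choice, over the space of paths, of a modulus of continuity with respect to a
neighbourhood of the diagonal. -/
theorem exists_continuous_path_modulus {Y : Type*} [TopologicalSpace Y]
    [TopologicalSpace.MetrizableSpace Y] {W : Set (Y × Y)} (hW : ∀ y, W ∈ 𝓝 (y, y)) :
    ∃ ε : C(C(I, Y), ℝ), ∀ P, 0 < ε P ∧ ∀ s t : I, dist s t ≤ ε P → (P s, P t) ∈ W := by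
  -- This metric makes the path space `C(I, Y)` metric, hence paracompact. Admissible moduli for a
  -- fixed path form an interval, so locally constant choices can be patched by a partition of
  -- unity.
  let := TopologicalSpace.metrizableSpaceMetric Y
  refine exists_continuous_forall_mem_convex_of_local_const
    (t := fun P : C(I, Y) => {ε : ℝ | 0 < ε ∧ ∀ s t : I, dist s t ≤ ε → (P s, P t) ∈ W})
    (fun P => ?_) fun P => ?_
  · refine Set.OrdConnected.convex ⟨?_⟩
    rintro x hx y hy z hz
    exact ⟨hx.1.trans_le hz.1, fun s t hst => hy.2 s t (hst.trans hz.2)⟩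
  · have hev : Continuous fun q : C(I, Y) × I × I => (q.1 q.2.1, q.1 q.2.2) := by fun_prop
    have h1 : ∀ s : I, ∀ᶠ q : C(I, Y) × I × I in 𝓝 (P, s, s), (q.1 q.2.1, q.1 q.2.2) ∈ W :=
      fun s => (hev.tendsto (P, s, s)).eventually (hW (P s))
    -- Compactness of the diagonal of `I` turns the pointwise neighbourhoods into one uniform
    -- estimate valid for all paths near `P`.
    have h2 : ∀ᶠ q : C(I, Y) × I × I in 𝓝 P ×ˢ 𝓤 I, (q.1 q.2.1, q.1 q.2.2) ∈ W := by
      rw [← nhdsSet_diagonal_eq_uniformity, ← nhdsSet_singleton,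
        ← isCompact_singleton.nhdsSet_prod_eq isCompact_diagonal, eventually_nhdsSet_iff_forall]
      rintro ⟨P', s, t⟩ ⟨h, h'⟩
      obtain rfl : P' = P := h
      obtain rfl : s = t := h'
      exact h1 s
    obtain ⟨p, hp, r, hr, hpr⟩ := Filter.eventually_prod_iff.1 h2
    obtain ⟨ε, hε, hεr⟩ := Metric.mem_uniformity_dist.1 hr
    refine ⟨ε / 2, hp.mono fun P' hP' => ⟨by positivity, fun s t hst => ?_⟩⟩
    exact hpr hP' (hεr (hst.trans_lt (by linarith)))

/-- In a manifold there is a continuous family of self-maps `Λ P t`, indexed by paths `P` and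
times `t`, that starts at the identity and moves `P 0`, and nothing else, to `P t`. -/
theorem exists_path_tracking {E : Type*} [NormedAddCommGroup E] [NormedSpace ℝ E]
    [ProperSpace E] {Y : Type*} [TopologicalSpace Y] [T2Space Y] [SecondCountableTopology Y]
    [Nonempty Y] [ChartedSpace E Y] :
    ∃ Λ : C(I, Y) → I → Y → Y, Continuous (fun q : C(I, Y) × I × Y => Λ q.1 q.2.1 q.2.2) ∧
      (∀ P y, Λ P 0 y = y) ∧ ∀ P t y, Λ P t y = P t ↔ y = P 0 := by
  have : LocallyCompactSpace Y := ChartedSpace.locallyCompactSpace E Y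
  have : TopologicalSpace.MetrizableSpace Y :=
    TopologicalSpace.metrizableSpace_of_t3_secondCountable Y
  obtain ⟨W, hW, htrack⟩ := exists_short_path_tracking (E := E) (Y := Y)
  obtain ⟨ε, hε⟩ := exists_continuous_path_modulus hW
  -- Subdivision times with steps of length at most `ε P`, stopped at time `t`.
  set τ : ℕ → C(I, Y) × I → ℝ := fun m b => min (m * ε b.1) b.2 with hτ
  have hτc : ∀ m, Continuous (τ m) := fun m => by fun_prop
  have hτ0 : ∀ m b, 0 ≤ τ m b := fun m b =>
    le_min (mul_nonneg m.cast_nonneg (hε b.1).1.le) b.2.2.1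
  have hτ1 : ∀ m b, τ m b ≤ 1 := fun m b => (min_le_right _ _).trans b.2.2.2
  have hτs : ∀ m b, τ m b ≤ τ (m + 1) b ∧ τ (m + 1) b ≤ τ m b + ε b.1 := by
    intro m b
    have := (hε b.1).1
    simp only [hτ, Nat.cast_add, Nat.cast_one, add_mul, one_mul]
    refine ⟨min_le_min (by linarith) le_rfl, ?_⟩
    rw [← min_add_add_right]
    exact min_le_min le_rfl (by linarith)
  have hτlim : ∀ b, ∃ N : ℕ, ∀ᶠ b' in 𝓝 b, ∀ m, N ≤ m → τ m b' = b'.2 := by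
    intro b
    -- The strict inequality `1 < N * ε P` persists for nearby paths, so the same `N` exhausts the
    -- interval there too.
    obtain ⟨N, hN⟩ := exists_nat_gt (1 / ε b.1)
    rw [div_lt_iff₀ (hε b.1).1] at hN
    refine ⟨N, ?_⟩
    have hc : Continuous fun b' : C(I, Y) × I => N * ε b'.1 := by fun_prop
    filter_upwards [(hc.tendsto b).eventually (lt_mem_nhds hN)] with b' hb' m hm
    refine min_eq_right (b'.2.2.2.trans (hb'.le.trans ?_))
    exact mul_le_mul_of_nonneg_right (by exact_mod_cast hm) (hε b'.1).1.le
  set Q : ℕ → C(I, Y) × I → ℝ → Y := fun m b u =>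
    b.1 (projIcc 0 1 zero_le_one (τ m b + u * (τ (m + 1) b - τ m b))) with hQ
  have hQc : ∀ m, Continuous fun q : (C(I, Y) × I) × ℝ => Q m q.1 q.2 := by
    intro m
    have h1 := hτc m
    have h2 := hτc (m + 1)
    have h3 : Continuous (projIcc (0 : ℝ) 1 zero_le_one) := continuous_projIcc
    fun_prop
  have hQW : ∀ m b, ∀ u ∈ Icc (0 : ℝ) 1, (Q m b 0, Q m b u) ∈ W := by
    intro m b u hu
    refine (hε b.1).2 _ _ ?_
    obtain ⟨h1, h2⟩ := hτs m b
    have h3 : 0 ≤ u * (τ (m + 1) b - τ m b) := mul_nonneg hu.1 (by linarith)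
    have h4 : u * (τ (m + 1) b - τ m b) ≤ τ (m + 1) b - τ m b :=
      mul_le_of_le_one_left (by linarith) hu.2
    have h5 := hτ0 m b
    have h6 := hτ1 (m + 1) b
    rw [projIcc_of_mem zero_le_one (x := τ m b + 0 * (τ (m + 1) b - τ m b))
      ⟨by linarith, by linarith⟩, projIcc_of_mem zero_le_one
      (x := τ m b + u * (τ (m + 1) b - τ m b)) ⟨by linarith, by linarith⟩, Subtype.dist_eq,
      Real.dist_eq, abs_le]
    constructor <;> simp only [zero_mul, add_zero] <;> linarith
  choose g hgc hg hgid using fun m => htrack (Q m) (hQc m) (hQW m)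
  have hgid' : ∀ m b, τ (m + 1) b = τ m b → ∀ z, g m b z = z := fun m b h =>
    hgid m b fun u _ => by simp only [hQ, h, sub_self, mul_zero]
  obtain ⟨G, hG1, hG2, hG3⟩ := exists_continuous_infinite_comp g hgc
    (fun b => by
      obtain ⟨N, hN⟩ := hτlim b
      refine ⟨N, hN.mono fun b' hb' m hm => hgid' m b' ?_⟩
      rw [hb' m hm, hb' (m + 1) (by omega)])
    (fun m b => b.1 (projIcc 0 1 zero_le_one (τ m b))) (fun b => b.1 b.2)
    (fun m b z => by
      have h := hg m b z
      simp only [hQ, one_mul, zero_mul, add_zero, add_sub_cancel] at h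
      exact h)
    (fun b => by
      obtain ⟨N, hN⟩ := hτlim b
      refine ⟨N, fun m hm => ?_⟩
      rw [hN.self_of_nhds m hm, projIcc_val])
  refine ⟨fun P t y => G (P, t) y, ?_, ?_, ?_⟩
  · exact hG1.comp (f := fun q : C(I, Y) × I × Y => ((q.1, q.2.1), q.2.2)) (by fun_prop)
  · intro P y
    refine hG3 _ (fun m => hgid' m _ ?_) y
    have h : ∀ m, τ m (P, 0) = 0 := fun m => le_antisymm (min_le_right _ _) (hτ0 m _)
    rw [h, h]
  · intro P t y
    have h : τ 0 (P, t) = 0 := by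
      simp only [hτ, Nat.cast_zero, zero_mul]
      exact min_eq_left t.2.1
    have := hG2 (P, t) y
    rw [h, projIcc_left] at this
    exact this

/-! ### Homotopy classes of paths with prescribed names for the end points -/

namespace Path.Homotopic.Quotient

variable {Y : Type*} [TopologicalSpace Y] {a b e : Y}

theorem symm_trans_cancel_left (p : Path.Homotopic.Quotient a b)
    (q : Path.Homotopic.Quotient b e) : p.symm.trans (p.trans q) = q := by
  rw [← trans_assoc, symm_trans, refl_trans]

theorem trans_symm_cancel_left (p : Path.Homotopic.Quotient a b)
    (q : Path.Homotopic.Quotient a e) : p.trans (p.symm.trans q) = q := by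
  rw [← trans_assoc, trans_symm, refl_trans]

theorem symm_trans_rev (p : Path.Homotopic.Quotient a b) (q : Path.Homotopic.Quotient b e) :
    (p.trans q).symm = q.symm.trans p.symm := by
  induction p using Path.Homotopic.Quotient.ind with | mk p =>
  induction q using Path.Homotopic.Quotient.ind with | mk q =>
  exact congrArg Path.Homotopic.Quotient.mk (Path.trans_symm p q)

end Path.Homotopic.Quotient

section PathClass

variable {X Y : Type*} [TopologicalSpace X] [TopologicalSpace Y]

/-- The homotopy class relative to the end points of `p : C(I, Y)`, as a class of paths between
points known to be equal to the end points of `p`. -/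
def pathClass (p : C(I, Y)) {a b : Y} (h0 : p 0 = a) (h1 : p 1 = b) :
    Path.Homotopic.Quotient a b :=
  .mk ⟨p, h0, h1⟩

theorem homotopicRel_iff_pathClass_eq {p q : C(I, Y)} {a b : Y} (hp0 : p 0 = a) (hp1 : p 1 = b)
    (hq0 : q 0 = a) (hq1 : q 1 = b) :
    p.HomotopicRel q {0, 1} ↔ pathClass p hp0 hp1 = pathClass q hq0 hq1 :=
  (Path.Homotopic.Quotient.eq (p := ⟨p, hp0, hp1⟩) (q := ⟨q, hq0, hq1⟩)).symm

theorem pathClass_const (p : C(I, Y)) {c : Y} (h : ∀ t, p t = c) :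
    pathClass p (h 0) (h 1) = Path.Homotopic.Quotient.refl c :=
  congrArg Path.Homotopic.Quotient.mk (Path.ext (funext h))

theorem pathClass_comp_trans (f : C(X, Y)) {x y z : X} (γ : Path x y) (δ : Path y z) {a b e : Y}
    (ha : f x = a) (hb : f y = b) (he : f z = e) :
    pathClass (f.comp (γ.trans δ).toContinuousMap) (by simpa using ha) (by simpa using he) =
      (pathClass (a := a) (b := b) (f.comp γ.toContinuousMap) (by simpa using ha)
        (by simpa using hb)).trans
      (pathClass (f.comp δ.toContinuousMap) (by simpa using hb) (by simpa using he)) := by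
  subst ha hb he
  exact congrArg Path.Homotopic.Quotient.mk (Path.map_trans γ δ f.continuous)

theorem pathClass_comp_symm (f : C(X, Y)) {x y : X} (γ : Path x y) {a b : Y}
    (ha : f x = a) (hb : f y = b) :
    pathClass (f.comp γ.symm.toContinuousMap) (by simpa using hb) (by simpa using ha) =
      (pathClass (a := a) (b := b) (f.comp γ.toContinuousMap) (by simpa using ha)
        (by simpa using hb)).symm := by
  subst ha hb
  exact congrArg Path.Homotopic.Quotient.mk (Path.map_symm γ f.continuous)

variable {f g k : C(X, Y)} {x x' : X}

theorem diagonalPath_zero (h : f.Homotopy g) (γ : Path x x') : diagonalPath h γ 0 = f x := by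
  simp [diagonalPath]

theorem diagonalPath_one (h : f.Homotopy g) (γ : Path x x') : diagonalPath h γ 1 = g x' := by
  simp [diagonalPath]

theorem diagonalPath_refl_homotopy (γ : Path x x') :
    diagonalPath (ContinuousMap.Homotopy.refl f) γ = f.comp γ.toContinuousMap :=
  rfl

/-- The path `t ↦ h (ζ t, γ t)`. -/
def slantedPath (h : f.Homotopy g) {s s' : I} (ζ : Path s s') (γ : Path x x') :
    Path (h (s, x)) (h (s', x')) :=
  (ζ.prod γ).map h.continuous

/-- The identity of the unit interval as a path. -/
def unitPath : Path (0 : I) 1 :=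
  ⟨ContinuousMap.id I, rfl, rfl⟩

theorem slantedPath_homotopic (h : f.Homotopy g) {s s' : I} {ζ ζ' : Path s s'} {γ γ' : Path x x'}
    (hζ : ζ.Homotopic ζ') (hγ : γ.Homotopic γ') :
    (slantedPath h ζ γ).Homotopic (slantedPath h ζ' γ') :=
  (hζ.map2 Path.Homotopic.prodHomotopy hγ).map fun F => F.map h.toContinuousMap

theorem pathClass_diagonalPath_congr (h : f.Homotopy g) {γ γ' : Path x x'}
    (hγ : γ.Homotopic γ') {a b : Y} (ha : f x = a) (hb : g x' = b) :
    pathClass (diagonalPath h γ) ((diagonalPath_zero h γ).trans ha)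
      ((diagonalPath_one h γ).trans hb) =
    pathClass (diagonalPath h γ') ((diagonalPath_zero h γ').trans ha)
      ((diagonalPath_one h γ').trans hb) :=
  (homotopicRel_iff_pathClass_eq _ _ _ _).1 (slantedPath_homotopic h (.refl unitPath) hγ)

/-- Up to homotopy, the homotopy may wait at time 0 while `δ` is traversed and only then run along
`γ`. -/
theorem pathClass_diagonalPath_path_trans (h : f.Homotopy g) {x y z : X} (δ : Path x y)
    (γ : Path y z) {a b e : Y} (ha : f x = a) (hb : f y = b) (he : g z = e) :
    pathClass (diagonalPath h (δ.trans γ)) ((diagonalPath_zero h _).trans ha)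
      ((diagonalPath_one h _).trans he) =
    (pathClass (a := a) (b := b) (f.comp δ.toContinuousMap) (by simpa using ha)
        (by simpa using hb)).trans
      (pathClass (diagonalPath h γ) ((diagonalPath_zero h γ).trans hb)
        ((diagonalPath_one h γ).trans he)) := by
  subst ha hb he
  have h1 : unitPath.Homotopic ((Path.refl 0).trans unitPath) :=
    (Path.Homotopic.refl_trans unitPath).symm
  have h2 := (homotopicRel_iff_pathClass_eq
    (p := diagonalPath h (δ.trans γ)) (a := f x) (b := g z) (diagonalPath_zero h _)
    (diagonalPath_one h _) (by simp) (by simp)).1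
    (slantedPath_homotopic h h1 (.refl (δ.trans γ)))
  rw [h2]
  refine congrArg Path.Homotopic.Quotient.mk (Path.ext (funext fun t => ?_))
  change h (((Path.refl 0).trans unitPath) t, (δ.trans γ) t) = Path.trans _ _ t
  simp only [Path.trans_apply]
  split_ifs
  · exact h.apply_zero _
  · rfl

/-- Replacing `γ` by `γ` followed by a constant path makes it reach its end at time 1/2, exactly
when the second homotopy takes over. -/
theorem pathClass_diagonalPath_homotopy_trans (h : f.Homotopy g) (k' : g.Homotopy k)
    (γ : Path x x') {a b e : Y} (ha : f x = a) (hb : g x' = b) (he : k x' = e) :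
    pathClass (diagonalPath (h.trans k') γ) ((diagonalPath_zero _ γ).trans ha)
      ((diagonalPath_one _ γ).trans he) =
    (pathClass (a := a) (b := b) (diagonalPath h γ) ((diagonalPath_zero h γ).trans ha)
        ((diagonalPath_one h γ).trans hb)).trans
      (pathClass (diagonalPath k' (Path.refl x')) ((diagonalPath_zero k' _).trans hb)
        ((diagonalPath_one k' _).trans he)) := by
  subst ha hb he
  rw [pathClass_diagonalPath_congr (h.trans k') (Path.Homotopic.trans_refl γ).symm rfl rfl]
  refine congrArg Path.Homotopic.Quotient.mk (Path.ext (funext fun t => ?_))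
  change (h.trans k') (t, (γ.trans (Path.refl x')) t) = Path.trans _ _ t
  simp only [ContinuousMap.Homotopy.trans_apply, Path.trans_apply]
  split_ifs <;> rfl

/-- The initial map sends `γ` to a constant path, so only the track of the end point remains. -/
theorem pathClass_diagonalPath_of_const {c : Y} (hf : ∀ x, f x = c) (h : f.Homotopy g)
    (γ : Path x x') {b : Y} (hb : g x' = b) :
    pathClass (diagonalPath h γ) ((diagonalPath_zero h γ).trans (hf x))
      ((diagonalPath_one h γ).trans hb) =
    pathClass (diagonalPath h (Path.refl x')) ((diagonalPath_zero h _).trans (hf x'))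
      ((diagonalPath_one h _).trans hb) := by
  rw [pathClass_diagonalPath_congr h (Path.Homotopic.trans_refl γ).symm (hf x) hb,
    pathClass_diagonalPath_path_trans h γ (Path.refl x') (hf x) (hf x') hb,
    pathClass_const _ (fun t => hf _), Path.Homotopic.Quotient.refl_trans]

end PathClass

/-! ### Moving coincidences of a constant map with other maps -/

section Coincidences

variable {X : Type u} {Y : Type v} [TopologicalSpace X] [TopologicalSpace Y] {n : ℕ}

open Path.Homotopic

theorem coinSet_apply_eq {f : Fin (n + 1) → C(X, Y)} {c : Y} (hf : ∀ x, f 0 x = c)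
    (x : CoinSet f) (i : Fin (n + 1)) : f i x = c :=
  (x.2 i 0).trans (hf x)

theorem nielsenEquiv_iff {f : Fin (n + 1) → C(X, Y)} {c : Y} (hf : ∀ x, f 0 x = c)
    (x y : CoinSet f) :
    NielsenEquiv f x y ↔ ∃ γ : Path (x : X) (y : X), ∀ i : Fin n,
      pathClass ((f i.succ).comp γ.toContinuousMap) (a := c) (b := c)
        (by simpa using coinSet_apply_eq hf x i.succ)
        (by simpa using coinSet_apply_eq hf y i.succ) = Quotient.refl c := by
  refine exists_congr fun γ => forall_congr' fun i => ?_
  rw [homotopicRel_iff_pathClass_eq (a := c) (b := c) (hf _) (hf _)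
    (by simpa using coinSet_apply_eq hf x i.succ) (by simpa using coinSet_apply_eq hf y i.succ),
    pathClass_const _ (fun _ => hf _), eq_comm]

/-- If the class of `x` is essential then, whatever the homotopies, the class of `x` twisted by any
loops at the value of the constant map is still met by a coincidence at the end. -/
theorem exists_twisted_coincidence {f : Fin (n + 1) → C(X, Y)} {c : Y} (hf : ∀ x, f 0 x = c)
    {Λ : C(I, Y) → I → Y → Y} (hΛc : Continuous fun q : C(I, Y) × I × Y => Λ q.1 q.2.1 q.2.2)
    (hΛ0 : ∀ P y, Λ P 0 y = y) (hΛ : ∀ P t y, Λ P t y = P t ↔ y = P 0)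
    (x : CoinSet f) (hx : NielsenClass.Essential (Quotient.mk (nielsenSetoid f) x))
    (ω : Fin n → Path.Homotopic.Quotient c c)
    {g : Fin (n + 1) → C(X, Y)} (h : ∀ i, (f i).Homotopy (g i)) :
    ∃ (x' : CoinSet g) (γ : Path (x : X) (x' : X)), ∀ (i : Fin n) (e : Y) (he : g 0 x' = e),
      pathClass (diagonalPath (h i.succ) γ) (a := c) (b := e)
        ((diagonalPath_zero _ γ).trans (coinSet_apply_eq hf x i.succ))
        ((diagonalPath_one _ γ).trans ((x'.2 i.succ 0).trans he)) =
      (ω i).trans (pathClass (diagonalPath (h 0) γ) ((diagonalPath_zero _ γ).trans (hf x))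
        ((diagonalPath_one _ γ).trans he)) := by
  choose w hw using fun i => Path.Homotopic.Quotient.mk_surjective (ω i).symm
  set q : ∀ x, Path c (g 0 x) := fun x =>
    ⟨⟨fun t => h 0 (t, x), by fun_prop⟩, ((h 0).apply_zero x).trans (hf x), (h 0).apply_one x⟩
    with hq
  have hqc : Continuous fun p : X × I => q p.1 p.2 :=
    (h 0).continuous.comp (f := fun p : X × I => (p.2, p.1)) (by fun_prop)
  have hPc : ∀ i, Continuous fun p : X × I => (q p.1).symm.trans ((w i).trans (q p.1)) p.2 := by
    intro i
    refine Path.trans_continuous_family (fun x => (q x).symm)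
      (Path.symm_continuous_family q hqc) (fun x => (w i).trans (q x)) ?_
    exact Path.trans_continuous_family (fun _ => w i) ((w i).continuous.comp continuous_snd) q hqc
  -- `P i x` transports the loop `w i`, of class `(ω i)⁻¹`, from `c` to `g 0 x` along the track of
  -- `x`.
  set P : Fin n → C(X, C(I, Y)) := fun i => ContinuousMap.curry ⟨_, hPc i⟩
  have hP : ∀ i x t, P i x t = (q x).symm.trans ((w i).trans (q x)) t := fun _ _ _ => rfl
  have hP0 : ∀ i x, P i x 0 = g 0 x := fun i x => by rw [hP, Path.source]
  have hP1 : ∀ i x, P i x 1 = g 0 x := fun i x => by rw [hP, Path.target]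
  have hKc : ∀ i : Fin n, Continuous fun p : I × X => Λ (P i p.2) p.1 (g i.succ p.2) := fun i =>
    hΛc.comp (f := fun p : I × X => (P i p.2, p.1, g i.succ p.2)) (by fun_prop)
  set g' : Fin (n + 1) → C(X, Y) := Fin.cons (g 0) fun i =>
    ⟨fun x => Λ (P i x) 1 (g i.succ x), (hKc i).comp (f := fun x => (1, x)) (by fun_prop)⟩
  set K : ∀ i : Fin n, (g i.succ).Homotopy (g' i.succ) := fun i =>
    { toFun := fun p => Λ (P i p.2) p.1 (g i.succ p.2)
      continuous_toFun := hKc i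
      map_zero_left := fun x => hΛ0 _ _
      map_one_left := fun x => rfl } with hK
  obtain ⟨F', x₁, x', hx₁, hx', γ, hγ⟩ := hx g' (Fin.cases
    ((h 0).trans (ContinuousMap.Homotopy.refl (g 0))) fun i => (h i.succ).trans (K i))
  obtain ⟨δ, hδ⟩ := (nielsenEquiv_iff hf x x₁).1 (Quotient.exact hx₁.symm)
  -- `P i x'` both starts and ends at `g 0 x'`, and only its start is moved to its end; coincidences
  -- of `g'` are therefore coincidences of `g`.
  have hg : ∀ i : Fin n, g i.succ x' = g 0 x' := by
    intro i
    have h1 : Λ (P i x') 1 (g i.succ x') = g 0 x' := x'.2 i.succ 0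
    rwa [← hP1 i x', hΛ, hP0] at h1
  have hx'g : (x' : X) ∈ CoinSet g := by
    have : ∀ i, g i x' = g 0 x' := Fin.cases rfl hg
    exact fun i j => (this i).trans (this j).symm
  refine ⟨⟨x', hx'g⟩, δ.trans γ, ?_⟩
  rintro i e rfl
  have hend : g' i.succ x' = g 0 x' := x'.2 i.succ 0
  have h1 : pathClass (diagonalPath ((h 0).trans (ContinuousMap.Homotopy.refl (g 0))) γ)
      ((diagonalPath_zero _ γ).trans (hf x₁)) (diagonalPath_one _ γ) =
      pathClass (diagonalPath ((h i.succ).trans (K i)) γ)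
        ((diagonalPath_zero _ γ).trans (coinSet_apply_eq hf x₁ i.succ))
        ((diagonalPath_one _ γ).trans hend) :=
    (homotopicRel_iff_pathClass_eq _ _ _ _).1 (hγ i)
  rw [pathClass_diagonalPath_homotopy_trans (h i.succ) (K i) γ (coinSet_apply_eq hf x₁ i.succ)
    (hg i) hend] at h1
  have h2 := pathClass_diagonalPath_homotopy_trans (h 0) (ContinuousMap.Homotopy.refl (g 0)) γ
    (hf x₁) rfl rfl
  rw [pathClass_const (diagonalPath (ContinuousMap.Homotopy.refl (g 0)) (Path.refl (x' : X)))
    (fun _ => rfl), Path.Homotopic.Quotient.trans_refl] at h2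
  have h3 : pathClass (diagonalPath (K i) (Path.refl (x' : X)))
      ((diagonalPath_zero (K i) _).trans (hg i)) ((diagonalPath_one (K i) _).trans hend) =
      (Path.Homotopic.Quotient.mk (q x')).symm.trans
        ((ω i).symm.trans (Path.Homotopic.Quotient.mk (q x'))) := by
    rw [← hw i]
    refine congrArg Path.Homotopic.Quotient.mk (Path.ext (funext fun t => ?_))
    change Λ (P i x') t (g i.succ x') = P i x' t
    rw [hΛ, hP0, hg]
  have h4 : pathClass (diagonalPath (h 0) (Path.refl (x' : X)))
      ((diagonalPath_zero _ _).trans (hf x')) (diagonalPath_one _ _) =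
      Path.Homotopic.Quotient.mk (q x') := rfl
  rw [pathClass_diagonalPath_path_trans (h i.succ) δ γ (coinSet_apply_eq hf x i.succ)
    (coinSet_apply_eq hf x₁ i.succ) (hg i), hδ, Path.Homotopic.Quotient.refl_trans,
    pathClass_diagonalPath_of_const hf (h 0) (δ.trans γ) rfl, h4]
  rw [h2, pathClass_diagonalPath_of_const hf (h 0) γ rfl, h4, h3] at h1
  generalize pathClass (diagonalPath (h i.succ) γ) _ _ = D at h1 ⊢
  -- `h1` now says `q = D q⁻¹ ω⁻¹ q`; multiplying on the right by `q⁻¹ ω q` isolates `D = ω q`.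
  have h5 := congrArg (fun A => A.trans ((Path.Homotopic.Quotient.mk (q x')).symm.trans
    ((ω i).trans (Path.Homotopic.Quotient.mk (q x'))))) h1
  simp only [Path.Homotopic.Quotient.trans_assoc,
    Path.Homotopic.Quotient.trans_symm_cancel_left,
    Path.Homotopic.Quotient.symm_trans_cancel_left, Path.Homotopic.Quotient.symm_trans,
    Path.Homotopic.Quotient.trans_refl] at h5
  exact h5.symm

/-- If the class of `x` is essential, then so is the class of `x` twisted by any loops at the value
of the constant map. -/
theorem exists_twisted_essential {f : Fin (n + 1) → C(X, Y)} {c : Y} (hf : ∀ x, f 0 x = c)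
    {Λ : C(I, Y) → I → Y → Y} (hΛc : Continuous fun q : C(I, Y) × I × Y => Λ q.1 q.2.1 q.2.2)
    (hΛ0 : ∀ P y, Λ P 0 y = y) (hΛ : ∀ P t y, Λ P t y = P t ↔ y = P 0)
    (x : CoinSet f) (hx : NielsenClass.Essential (Quotient.mk (nielsenSetoid f) x))
    (ω : Fin n → Path.Homotopic.Quotient c c) :
    ∃ (y : CoinSet f) (γ : Path (x : X) (y : X)),
      (∀ i : Fin n, pathClass ((f i.succ).comp γ.toContinuousMap)
        (by simpa using coinSet_apply_eq hf x i.succ)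
        (by simpa using coinSet_apply_eq hf y i.succ) = ω i) ∧
      NielsenClass.Essential (Quotient.mk (nielsenSetoid f) y) := by
  obtain ⟨y, γ, hγ⟩ := exists_twisted_coincidence hf hΛc hΛ0 hΛ x hx ω
    fun i => ContinuousMap.Homotopy.refl (f i)
  have hγ' : ∀ i : Fin n, pathClass ((f i.succ).comp γ.toContinuousMap)
      (by simpa using coinSet_apply_eq hf x i.succ)
      (by simpa using coinSet_apply_eq hf y i.succ) = ω i := by
    intro i
    have h1 := hγ i c (hf y)
    simp only [diagonalPath_refl_homotopy] at h1
    rw [h1, pathClass_const _ (fun _ => hf _), Path.Homotopic.Quotient.trans_refl]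
  refine ⟨y, γ, hγ', fun g h => ?_⟩
  -- The same twist is used as for `y`; going back along `γ` contributes `ω⁻¹`, which cancels it.
  obtain ⟨x', δ, hδ⟩ := exists_twisted_coincidence hf hΛc hΛ0 hΛ x hx ω h
  refine ⟨Quotient.mk _ x', y, x', rfl, rfl, γ.symm.trans δ, fun i => ?_⟩
  rw [homotopicRel_iff_pathClass_eq (a := c) (b := g 0 x')
    ((diagonalPath_zero _ _).trans (hf y)) (diagonalPath_one _ _)
    ((diagonalPath_zero _ _).trans (coinSet_apply_eq hf y i.succ))
    ((diagonalPath_one _ _).trans (x'.2 i.succ 0)),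
    pathClass_diagonalPath_path_trans (h i.succ) γ.symm δ (coinSet_apply_eq hf y i.succ)
      (coinSet_apply_eq hf x i.succ) (x'.2 i.succ 0), hδ i _ rfl,
    pathClass_comp_symm (f i.succ) γ (coinSet_apply_eq hf x i.succ)
      (coinSet_apply_eq hf y i.succ), hγ', Path.Homotopic.Quotient.symm_trans_cancel_left,
    pathClass_diagonalPath_of_const hf (h 0) (γ.symm.trans δ) rfl,
    pathClass_diagonalPath_of_const hf (h 0) δ rfl]

/-! ### Coincidences and Reidemeister classes -/

theorem inducedHom_apply (g : C(X, Y)) (x₀ : X) {y₀ : Y} (w : Path (g x₀) y₀)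
    (z : Path.Homotopic.Quotient x₀ x₀) :
    inducedHom g x₀ w z = (Path.Homotopic.Quotient.mk w).symm.trans
      ((z.map g).trans (Path.Homotopic.Quotient.mk w)) :=
  rfl

/-- The coincidence point `p` represents the coordinates `α`, with respect to the base points
`x₀`, `y₀`, the paths `w` and a path class `κ` from `y₀` to the value of the constant map. -/
def Represents (f : Fin (n + 1) → C(X, Y)) {c : Y} (hf : ∀ x, f 0 x = c) {x₀ : X} {y₀ : Y}
    (w : ∀ i, Path (f i x₀) y₀) (κ : Path.Homotopic.Quotient y₀ c)
    (α : Fin n → FundamentalGroup Y y₀) (p : CoinSet f) : Prop :=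
  ∃ γ : Path x₀ (p : X), ∀ i : Fin n,
    pathClass ((f i.succ).comp γ.toContinuousMap) (a := f i.succ x₀) (b := c) (by simp)
      (by simpa using coinSet_apply_eq hf p i.succ) =
    (Path.Homotopic.Quotient.mk (w i.succ)).trans ((FundamentalGroup.toPath (α i)).trans κ)

/-- Paths `η` from `p` to `q` correspond to loops `γ η δ⁻¹` at `x₀`. Since `φ₁` is trivial, the
Reidemeister relation says `φᵢ(z) = βᵢ⁻¹ αᵢ`, which holds for this loop exactly when `fᵢ ∘ η` is
null-homotopic. -/
theorem Represents.nielsenEquiv_iff {f : Fin (n + 1) → C(X, Y)} {c : Y} {hf : ∀ x, f 0 x = c}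
    {x₀ : X} {y₀ : Y} {w : ∀ i, Path (f i x₀) y₀} {κ : Path.Homotopic.Quotient y₀ c}
    {α β : Fin n → FundamentalGroup Y y₀} {p q : CoinSet f} (hp : Represents f hf w κ α p)
    (hq : Represents f hf w κ β q) :
    NielsenEquiv f p q ↔ reidemeisterSetoid (fun i => inducedHom (f i) x₀ (w i)) α β := by
  obtain ⟨γ, hγ⟩ := hp
  obtain ⟨δ, hδ⟩ := hq
  have hφ0 : ∀ z : Path.Homotopic.Quotient x₀ x₀, inducedHom (f 0) x₀ (w 0) z = 1 := by
    intro z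
    have h1 : z.map (f 0) = Path.Homotopic.Quotient.refl (f 0 x₀) := by
      induction z using Path.Homotopic.Quotient.ind with | mk z =>
      exact pathClass_const (z.map (f 0).continuous).toContinuousMap
        fun t => (hf _).trans (hf x₀).symm
    rw [inducedHom_apply, h1, Path.Homotopic.Quotient.refl_trans,
      Path.Homotopic.Quotient.symm_trans]
    rfl
  have hpc : ∀ i : Fin n, f i.succ p = c := fun i => coinSet_apply_eq hf p i.succ
  have hqc : ∀ i : Fin n, f i.succ q = c := fun i => coinSet_apply_eq hf q i.succ
  rw [_root_.nielsenEquiv_iff hf]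
  constructor
  · rintro ⟨η, hη⟩
    refine ⟨Path.Homotopic.Quotient.mk ((γ.trans η).trans δ.symm), fun i => ?_⟩
    have h1 : inducedHom (f i.succ) x₀ (w i.succ)
        (Path.Homotopic.Quotient.mk ((γ.trans η).trans δ.symm)) = (β i)⁻¹ * α i := by
      have h2 : (Path.Homotopic.Quotient.mk ((γ.trans η).trans δ.symm)).map (f i.succ) =
          pathClass ((f i.succ).comp ((γ.trans η).trans δ.symm).toContinuousMap)
            (by simp) (by simp) := rfl
      rw [inducedHom_apply, h2, pathClass_comp_trans (f i.succ) (γ.trans η) δ.symm rfl (hqc i) rfl,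
        pathClass_comp_trans (f i.succ) γ η rfl (hpc i) (hqc i), hη,
        pathClass_comp_symm (f i.succ) δ rfl (hqc i), hγ, hδ, FundamentalGroup.mul_def,
        FundamentalGroup.inv_def]
      simp only [Path.Homotopic.Quotient.symm_trans_rev, Path.Homotopic.Quotient.trans_assoc,
        Path.Homotopic.Quotient.trans_symm_cancel_left,
        Path.Homotopic.Quotient.symm_trans_cancel_left, Path.Homotopic.Quotient.symm_trans,
        Path.Homotopic.Quotient.trans_refl]
    rw [hφ0, h1, one_mul, mul_inv_rev, inv_inv, mul_inv_cancel_left]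
  · rintro ⟨z, hz⟩
    obtain ⟨ζ, rfl⟩ := Path.Homotopic.Quotient.mk_surjective z
    refine ⟨γ.symm.trans (ζ.trans δ), fun i => ?_⟩
    have h1 : inducedHom (f i.succ) x₀ (w i.succ) (Path.Homotopic.Quotient.mk ζ) =
        (β i)⁻¹ * α i := by
      rw [hz i, hφ0, one_mul, mul_inv_rev, inv_inv, inv_mul_cancel_right]
    have h2 : pathClass ((f i.succ).comp ζ.toContinuousMap) (a := f i.succ x₀) (b := f i.succ x₀)
        (by simp) (by simp) = (Path.Homotopic.Quotient.mk ζ).map (f i.succ) := rfl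
    rw [inducedHom_apply, FundamentalGroup.mul_def, FundamentalGroup.inv_def, ← h2] at h1
    rw [pathClass_comp_trans (f i.succ) γ.symm (ζ.trans δ) (hpc i) rfl (hqc i),
      pathClass_comp_trans (f i.succ) ζ δ rfl rfl (hqc i),
      pathClass_comp_symm (f i.succ) γ rfl (hpc i), hγ, hδ]
    generalize pathClass ((f i.succ).comp ζ.toContinuousMap) _ _ = Z at h1 ⊢
    have h3 := congrArg (fun A => (Path.Homotopic.Quotient.mk (w i.succ)).trans
      (A.trans ((β i).toPath.trans κ))) h1
    simp only [Path.Homotopic.Quotient.trans_assoc,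
      Path.Homotopic.Quotient.trans_symm_cancel_left,
      Path.Homotopic.Quotient.symm_trans_cancel_left] at h3
    rw [h3]
    simp only [Path.Homotopic.Quotient.symm_trans_rev, Path.Homotopic.Quotient.trans_assoc,
      Path.Homotopic.Quotient.symm_trans_cancel_left, Path.Homotopic.Quotient.symm_trans]

/-- Twisting `x` by the images of a path from `x` to `p` yields the class of `p`, so every class is
essential. Other twists realise any prescribed coordinates, which gives surjectivity onto
Reidemeister classes. -/
theorem lift_nielsenNumber_eq_of_essential [PathConnectedSpace X] {f : Fin (n + 1) → C(X, Y)}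
    {c : Y} (hf : ∀ x, f 0 x = c)
    {Λ : C(I, Y) → I → Y → Y} (hΛc : Continuous fun q : C(I, Y) × I × Y => Λ q.1 q.2.1 q.2.2)
    (hΛ0 : ∀ P y, Λ P 0 y = y) (hΛ : ∀ P t y, Λ P t y = P t ↔ y = P 0)
    (x : CoinSet f) (hx : NielsenClass.Essential (Quotient.mk (nielsenSetoid f) x))
    (x₀ : X) (y₀ : Y) (w : ∀ i, Path (f i x₀) y₀) :
    Cardinal.lift.{v} (nielsenNumber f) = Cardinal.lift.{u} (reidemeisterNumber f x₀ y₀ w) := by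
  have hess := exists_twisted_essential hf hΛc hΛ0 hΛ x hx
  have hall : ∀ F : NielsenClass f, F.Essential := by
    refine Quotient.ind fun p => ?_
    have γ := PathConnectedSpace.somePath (x : X) (p : X)
    obtain ⟨y, δ, hδ, hy⟩ := hess fun i => pathClass ((f i.succ).comp γ.toContinuousMap)
      (by simpa using coinSet_apply_eq hf x i.succ) (by simpa using coinSet_apply_eq hf p i.succ)
    have : (Quotient.mk (nielsenSetoid f) p) = Quotient.mk (nielsenSetoid f) y := by
      refine Quotient.sound ((_root_.nielsenEquiv_iff hf p y).2 ⟨γ.symm.trans δ, fun i => ?_⟩)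
      rw [pathClass_comp_trans (f i.succ) γ.symm δ (coinSet_apply_eq hf p i.succ)
        (coinSet_apply_eq hf x i.succ) (coinSet_apply_eq hf y i.succ), hδ,
        pathClass_comp_symm (f i.succ) γ (coinSet_apply_eq hf x i.succ)
          (coinSet_apply_eq hf p i.succ), Path.Homotopic.Quotient.symm_trans]
    rwa [this]
  set κ : Path.Homotopic.Quotient y₀ c := (Path.Homotopic.Quotient.mk (w 0)).symm.cast rfl
    (hf x₀).symm
  have hrep : ∀ α, ∃ p, Represents f hf w κ α p := by
    intro α
    have θ := PathConnectedSpace.somePath x₀ (x : X)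
    -- The twist is the difference between the image of `θ` and the path class prescribed by `α i`.
    obtain ⟨y, δ, hδ, -⟩ := hess fun i => (pathClass ((f i.succ).comp θ.toContinuousMap)
      (a := f i.succ x₀) (by simp) (by simpa using coinSet_apply_eq hf x i.succ)).symm.trans
      ((Path.Homotopic.Quotient.mk (w i.succ)).trans ((FundamentalGroup.toPath (α i)).trans κ))
    refine ⟨y, θ.trans δ, fun i => ?_⟩
    rw [pathClass_comp_trans (f i.succ) θ δ rfl (coinSet_apply_eq hf x i.succ)
      (coinSet_apply_eq hf y i.succ), hδ, Path.Homotopic.Quotient.trans_symm_cancel_left]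
  have hcoord : ∀ p, ∃ α, Represents f hf w κ α p := by
    intro p
    have γ := PathConnectedSpace.somePath x₀ (p : X)
    refine ⟨fun i => FundamentalGroup.fromPath ((Path.Homotopic.Quotient.mk (w i.succ)).symm.trans
      ((pathClass ((f i.succ).comp γ.toContinuousMap) (a := f i.succ x₀) (by simp)
        (by simpa using coinSet_apply_eq hf p i.succ)).trans κ.symm)), γ, fun i => ?_⟩
    simp [Path.Homotopic.Quotient.trans_symm_cancel_left]
  choose r hr using hrep
  choose α hα using hcoord
  refine Cardinal.lift_mk_eq'.2 ⟨(Equiv.subtypeUnivEquiv hall).trans ?_⟩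
  exact
    { toFun := Quotient.map α fun p q h => ((hα p).nielsenEquiv_iff (hα q)).1 h
      invFun := Quotient.map r fun a b h => ((hr a).nielsenEquiv_iff (hr b)).2 h
      left_inv := Quotient.ind fun p => Quotient.sound
        (((hr (α p)).nielsenEquiv_iff (hα p)).2 ((reidemeisterSetoid _).refl _))
      right_inv := Quotient.ind fun a => Quotient.sound
        (((hα (r a)).nielsenEquiv_iff (hr a)).1 (nielsenEquiv_refl f _)) }

end Coincidences

theorem theorem3 {X : Type u} [TopologicalSpace X] [PathConnectedSpace X]
    {d : ℕ} {Y : Type v} [TopologicalSpace Y] [T2Space Y] [SecondCountableTopology Y]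
    [ConnectedSpace Y] [ChartedSpace (EuclideanSpace ℝ (Fin d)) Y]
    (c : Y) {n : ℕ} (hn : 1 ≤ n) (f : Fin n → C(X, Y)) :
    nielsenNumber (Fin.cons (ContinuousMap.const X c) f : Fin (n + 1) → C(X, Y)) = 0 ∨
    ∀ (x₀ : X) (y₀ : Y)
      (w : ∀ i, Path ((Fin.cons (ContinuousMap.const X c) f : Fin (n + 1) → C(X, Y)) i x₀) y₀),
      Cardinal.lift.{v} (nielsenNumber
          (Fin.cons (ContinuousMap.const X c) f : Fin (n + 1) → C(X, Y))) =
        Cardinal.lift.{u} (reidemeisterNumber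
          (Fin.cons (ContinuousMap.const X c) f : Fin (n + 1) → C(X, Y)) x₀ y₀ w) := by
  obtain ⟨Λ, hΛc, hΛ0, hΛ⟩ := exists_path_tracking (E := EuclideanSpace ℝ (Fin d)) (Y := Y)
  refine or_iff_not_imp_left.2 fun hN x₀ y₀ w => ?_
  obtain ⟨⟨F, hF⟩⟩ := Cardinal.mk_ne_zero_iff.1 hN
  obtain ⟨x, rfl⟩ := Quotient.exists_rep F
  exact lift_nielsenNumber_eq_of_essential (fun _ => rfl) hΛc hΛ0 hΛ x hF x₀ y₀ w
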